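/- Let $w\colon\mathbb{R}\to\mathbb{R}$ be a continuous function without zeros such that $1/w$ is integrable neither on $(-\infty,0)$ nor on $(0,\infty)$. Let $$L^2_{|w|}(\mathbb{R})=\Bigl\{x\colon\mathbb{R}\to\mathbb{C}\ \text{measurable}\;;\;\int_{\mathbb{R}}|w(\xi)|\,|x(\xi)|^2\,\mathrm{d}\xi<\infty\Bigr\}$$ (functions modulo equality almost everywhere), a Hilbert space with scalar product $\langle x,y\rangle=\int_{\mathbb{R}}\overline{x(\xi)}\,|w(\xi)|\,y(\xi)\,\mathrm{d}\xi$. Put $p_w(\xi)=\int_0^{\xi}w(\zeta)^{-1}\,\mathrm{d}\zeta$. Then $p_w\colon\mathbb{R}\to\mathbb{R}$ is bijective, so that $$\mu_w(\xi,t)=p_w^{-1}\bigl(p_w(\xi)+t\bigr)-\xi\qquad(\xi,t\in\mathbb{R})$$ is well defined. Let $A_w\colon D(A_w)\to L^2_{|w|}(\mathbb{R})$ be the operator $$A_wx=(wx)',\qquad D(A_w)=\bigl\{x\in L^2_{|w|}(\mathbb{R})\;;\;wx\in \mathrm{AC}_{\mathrm{loc}}(\mathbb{R})\text{ and }(wx)'\in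 L^2_{|w|}(\mathbb{R})\bigr\},$$ where $wx\in\mathrm{AC}_{\mathrm{loc}}(\mathbb{R})$ means that $wx$ agrees almost everywhere with a complex-valued function that is absolutely continuous on every compact interval, and $(wx)'$ is the almost everywhere derivative of that function. Then $A_w$ is the generator of a $C_0$-group $(T_w(t))_{t\in\mathbb{R}}$ of unitary operators on $L^2_{|w|}(\mathbb{R})$, that is, of a strongly continuous family with $T_w(0)=I$ and $T_w(s+t)=T_w(s)T_w(t)$ for all $s,t\in\mathbb{R}$, whose generator maps $x$ to $\lim_{t\to0}t^{-1}(T_w(t)x-x)$ on the domain of all $x$ for which this two-sided limit exists. The group is given by $$(T_w(t)x)(\xi)=\frac{w(\xi+\mu_w(\xi,t))}{w(\xi)}\,x(\xi+\mu_w(\xi,t))$$ for all $t\in\mathbb{R}$, all $x\in L^2_{|w|}(\mathbb{R})$ and almost every $\xi\in\mathbb{R}$. -/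

import Mathlib

open MeasureTheory Filter Topology
open scoped ENNReal

noncomputable section

namespace WeightedTransport

/-! ### Strongly continuous groups and their generators -/

section C0Group

variable {E : Type*} [NormedAddCommGroup E] [NormedSpace ℂ E]

/-- A family `(T t)` of bounded operators, indexed by all real `t`, is a `C₀`-group: it satisfies
`T 0 = 1` and the evolution property, and all its orbits are continuous. -/
structure IsC0Group (T : ℝ → E →L[ℂ] E) : Prop where
  map_zero : T 0 = 1
  map_add : ∀ s t : ℝ, T (s + t) = T s * T t
  continuous_orbit : ∀ x : E, Continuous fun t : ℝ => T t x

/-- The difference quotient `(T t x - x) / t`. -/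
def diffQuot (T : ℝ → E →L[ℂ] E) (x : E) (t : ℝ) : E := ((t⁻¹ : ℝ) : ℂ) • (T t x - x)

theorem diffQuot_add (T : ℝ → E →L[ℂ] E) (x y : E) :
    diffQuot T (x + y) = fun t => diffQuot T x t + diffQuot T y t := by
  funext t
  simp only [diffQuot, map_add, ← smul_add]
  congr 1
  abel

theorem diffQuot_smul (T : ℝ → E →L[ℂ] E) (c : ℂ) (x : E) :
    diffQuot T (c • x) = fun t => c • diffQuot T x t := by
  funext t
  simp only [diffQuot, map_smul, ← smul_sub]
  exact smul_comm _ _ _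

/-- The (infinitesimal) generator of a family `(T t)`: its domain consists of all `x` for which
`lim_{t → 0} (T t x - x) / t` exists (two-sided limit), and it maps `x` to this limit. -/
def generator (T : ℝ → E →L[ℂ] E) : E →ₗ.[ℂ] E where
  domain :=
    { carrier := {x | ∃ y, Tendsto (diffQuot T x) (𝓝[≠] 0) (𝓝 y)}
      zero_mem' := ⟨0, by
        have h : diffQuot T (0 : E) = fun _ => 0 := by
          funext t; simp [diffQuot]
        rw [h]; exact tendsto_const_nhds⟩
      add_mem' := by
        rintro x x' ⟨y, hy⟩ ⟨y', hy'⟩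
        exact ⟨y + y', by rw [diffQuot_add]; exact hy.add hy'⟩
      smul_mem' := by
        rintro c x ⟨y, hy⟩
        exact ⟨c • y, by rw [diffQuot_smul]; exact hy.const_smul c⟩ }
  toFun :=
    { toFun := fun x => Classical.choose x.2
      map_add' := fun x x' => by
        have h := Classical.choose_spec (x + x').2
        have h' := (Classical.choose_spec x.2).add (Classical.choose_spec x'.2)
        rw [← diffQuot_add] at h'
        exact tendsto_nhds_unique h h'
      map_smul' := fun c x => by
        have h := Classical.choose_spec (c • x).2
        have h' := (Classical.choose_spec x.2).const_smul c
        rw [← diffQuot_smul] at h'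
        exact tendsto_nhds_unique h h' }

end C0Group

/-! ### Weighted `L²`-spaces and locally absolutely continuous functions -/

/-- The measure `|w(ξ)| dξ` on the real line. -/
def weightMeasure (w : ℝ → ℝ) : Measure ℝ :=
  volume.withDensity fun ξ => ENNReal.ofReal |w ξ|

/-- The Hilbert space `L²_{|w|}(ℝ)` of complex-valued functions, with
`⟨x, y⟩ = ∫ conj (x ξ) * y ξ * |w ξ| dξ`. -/
abbrev WeightedL2 (w : ℝ → ℝ) : Type := Lp ℂ 2 (weightMeasure w)

/-- Locally absolutely continuous functions on the line: absolutely continuous on every compact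
interval. -/
def LocAC (z : ℝ → ℂ) : Prop := ∀ a b : ℝ, AbsolutelyContinuousOnInterval z a b

theorem LocAC.ae_differentiableAt {z : ℝ → ℂ} (hz : LocAC z) :
    ∀ᵐ ξ : ℝ, DifferentiableAt ℝ z ξ := by
  have h : ∀ᵐ ξ : ℝ, ∀ n : ℕ, ξ ∈ Set.uIcc (-(n : ℝ)) n → DifferentiableAt ℝ z ξ :=
    ae_all_iff.2 fun n => (hz (-(n : ℝ)) n).boundedVariationOn.ae_differentiableAt_of_mem_uIcc
  filter_upwards [h] with ξ hξ
  obtain ⟨n, hn⟩ := exists_nat_ge |ξ|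
  exact hξ n (Set.mem_uIcc.2 (Or.inl (abs_le.1 hn)))

theorem LocAC.continuous {z : ℝ → ℂ} (hz : LocAC z) : Continuous z := by
  refine continuous_iff_continuousAt.2 fun ξ => ?_
  refine (hz (ξ - 1) (ξ + 1)).continuousOn.continuousAt ?_
  rw [Set.uIcc_of_le (by linarith)]
  exact Icc_mem_nhds (by linarith) (by linarith)

theorem LocAC.add {z z' : ℝ → ℂ} (hz : LocAC z) (hz' : LocAC z') : LocAC (z + z') :=
  fun a b => (hz a b).add (hz' a b)

theorem LocAC.const_smul {z : ℝ → ℂ} (hz : LocAC z) (c : ℂ) : LocAC (c • z) :=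
  fun a b => (hz a b).const_smul c

theorem volume_ac_weightMeasure {w : ℝ → ℝ} (hw : Continuous w) (hw0 : ∀ ξ, w ξ ≠ 0) :
    volume ≪ weightMeasure w :=
  withDensity_absolutelyContinuous' (by fun_prop) (by simp [hw0])

theorem weightMeasure_ac_volume (w : ℝ → ℝ) : weightMeasure w ≪ volume :=
  withDensity_absolutelyContinuous _ _

/-- `z` is the locally absolutely continuous representative of `w x`, and its almost everywhere
derivative lies in `L²_{|w|}(ℝ)`. -/
structure IsACRep (w : ℝ → ℝ) (x : WeightedL2 w) (z : ℝ → ℂ) : Prop where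
  locAC : LocAC z
  ae_eq : ∀ᵐ ξ : ℝ, z ξ = (w ξ : ℂ) * x ξ
  memLp : MemLp (deriv z) 2 (weightMeasure w)

section Rep

variable {w : ℝ → ℝ} {x x' : WeightedL2 w} {z z' : ℝ → ℂ}

theorem IsACRep.unique (h : IsACRep w x z) (h' : IsACRep w x z') : z = z' := by
  refine (h.locAC.continuous.ae_eq_iff_eq volume h'.locAC.continuous).1 ?_
  filter_upwards [h.ae_eq, h'.ae_eq] with ξ h1 h2
  rw [h1, h2]

theorem deriv_add_ae (hz : LocAC z) (hz' : LocAC z') :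
    deriv (z + z') =ᵐ[weightMeasure w] deriv z + deriv z' := by
  refine (weightMeasure_ac_volume w).ae_le ?_
  filter_upwards [hz.ae_differentiableAt, hz'.ae_differentiableAt] with ξ h1 h2
  exact deriv_add h1 h2

theorem deriv_smul_ae (hz : LocAC z) (c : ℂ) :
    deriv (c • z) =ᵐ[weightMeasure w] c • deriv z := by
  refine (weightMeasure_ac_volume w).ae_le ?_
  filter_upwards [hz.ae_differentiableAt] with ξ h1
  exact deriv_const_smul c h1

theorem IsACRep.add (hw : Continuous w) (hw0 : ∀ ξ, w ξ ≠ 0)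
    (h : IsACRep w x z) (h' : IsACRep w x' z') : IsACRep w (x + x') (z + z') where
  locAC := h.locAC.add h'.locAC
  ae_eq := by
    filter_upwards [h.ae_eq, h'.ae_eq,
      (volume_ac_weightMeasure hw hw0).ae_le (Lp.coeFn_add x x')] with ξ h1 h2 h3
    rw [h3, Pi.add_apply, Pi.add_apply, h1, h2, mul_add]
  memLp := (h.memLp.add h'.memLp).ae_eq (deriv_add_ae h.locAC h'.locAC).symm

theorem IsACRep.smul (hw : Continuous w) (hw0 : ∀ ξ, w ξ ≠ 0) (c : ℂ)
    (h : IsACRep w x z) : IsACRep w (c • x) (c • z) where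
  locAC := h.locAC.const_smul c
  ae_eq := by
    filter_upwards [h.ae_eq,
      (volume_ac_weightMeasure hw hw0).ae_le (Lp.coeFn_smul c x)] with ξ h1 h3
    rw [h3, Pi.smul_apply, Pi.smul_apply, h1, smul_eq_mul, smul_eq_mul, mul_left_comm]
  memLp := (h.memLp.const_smul c).ae_eq (deriv_smul_ae h.locAC c).symm

theorem IsACRep.zero (hw : Continuous w) (hw0 : ∀ ξ, w ξ ≠ 0) :
    IsACRep w (0 : WeightedL2 w) (0 : ℝ → ℂ) where
  locAC := fun a b => by
    rw [absolutelyContinuousOnInterval_iff]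
    intro ε hε
    exact ⟨1, one_pos, fun E _ _ => by simpa using hε⟩
  ae_eq := by
    filter_upwards [(volume_ac_weightMeasure hw hw0).ae_le
      (Lp.coeFn_zero ℂ 2 (weightMeasure w))] with ξ h
    rw [h]; simp
  memLp := by
    have h : deriv (0 : ℝ → ℂ) = 0 := by funext ξ; simp
    rw [h]; exact MemLp.zero

end Rep

/-- The weighted transport operator `A_w x = (w x)'` in `L²_{|w|}(ℝ)` on its maximal domain: the
domain consists of all `x` such that `w x` is locally absolutely continuous (as a class of
functions modulo null sets: has a representative that is) with
`(w x)'` (derivative almost everywhere) in `L²_{|w|}(ℝ)`. -/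
def transportOp (w : ℝ → ℝ) (hw : Continuous w) (hw0 : ∀ ξ, w ξ ≠ 0) :
    WeightedL2 w →ₗ.[ℂ] WeightedL2 w where
  domain :=
    { carrier := {x | ∃ z : ℝ → ℂ, IsACRep w x z}
      zero_mem' := ⟨0, IsACRep.zero hw hw0⟩
      add_mem' := by
        rintro x x' ⟨z, hz⟩ ⟨z', hz'⟩
        exact ⟨z + z', hz.add hw hw0 hz'⟩
      smul_mem' := by
        rintro c x ⟨z, hz⟩
        exact ⟨c • z, hz.smul hw hw0 c⟩ }
  toFun :=
    { toFun := fun x => (Classical.choose_spec x.2).memLp.toLp (deriv (Classical.choose x.2))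
      map_add' := fun x x' => by
        have h := Classical.choose_spec x.2
        have h' := Classical.choose_spec x'.2
        rw [← MemLp.toLp_add h.memLp h'.memLp]
        refine MemLp.toLp_congr _ _ ?_
        rw [(Classical.choose_spec (x + x').2).unique (h.add hw hw0 h')]
        exact deriv_add_ae h.locAC h'.locAC
      map_smul' := fun c x => by
        have h := Classical.choose_spec x.2
        rw [RingHom.id_apply, ← MemLp.toLp_const_smul c h.memLp]
        refine MemLp.toLp_congr _ _ ?_
        rw [(Classical.choose_spec (c • x).2).unique (h.smul hw hw0 c)]
        exact deriv_smul_ae h.locAC c }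

/-! ### The flow -/

/-- `p_w(ξ) = ∫₀^ξ w(ζ)⁻¹ dζ`. -/
def pFun (w : ℝ → ℝ) (ξ : ℝ) : ℝ := ∫ ζ in (0 : ℝ)..ξ, (w ζ)⁻¹

/-- `μ_w(ξ, t) = p_w⁻¹(p_w(ξ) + t) - ξ`; here `Function.invFun (pFun w)` is the inverse function of
`p_w` whenever `p_w` is bijective. -/
def muFun (w : ℝ → ℝ) (ξ t : ℝ) : ℝ := Function.invFun (pFun w) (pFun w ξ + t) - ξ

end WeightedTransport

end

/-!
As `p_w` has derivative `1 / w`, the map `y ↦ w⁻¹ (y ∘ p_w)` is a unitary equivalence of `L²(ℝ)`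
and `L²_{|w|}(ℝ)`, and it carries the derivative on its maximal domain to `A_w`. The derivative
generates the translation group: for any `C₀`-group `T`, a pair `(x, v)` lies in the graph of the
generator iff `T t x - x = ∫₀ᵗ T r v dr` for all `t`, and for translations and a pair `(y, u)` this
says that `y - ∫₀ˢ u` is almost everywhere invariant under every translation, i.e. almost everywhere
constant. The formula for the group follows from `p_w(ξ + μ_w(ξ, t)) = p_w(ξ) + t`.
-/

noncomputable section

namespace WeightedTransport

/-! ### Interval integrals and locally absolutely continuous functions -/

section IntervalIntegral

variable {E : Type*} [NormedAddCommGroup E]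

theorem intervalIntegrable_of_locallyIntegrable {μ : Measure ℝ} {u : ℝ → E}
    (hu : LocallyIntegrable u μ) (a b : ℝ) : IntervalIntegrable u μ a b :=
  intervalIntegrable_iff.2 <|
    (hu.integrableOn_isCompact isCompact_uIcc).mono_set Set.uIoc_subset_uIcc

variable [NormedSpace ℝ E]

theorem integral_add_sub_comm {U : ℝ → E} (hU : LocallyIntegrable U) (b t : ℝ) :
    ∫ r in (0 : ℝ)..t, (U (r + b) - U r) = ∫ s in (0 : ℝ)..b, (U (s + t) - U s) := by
  have hi (a b : ℝ) := intervalIntegrable_of_locallyIntegrable hU a b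
  have hshift (c x y : ℝ) : IntervalIntegrable (fun r => U (r + c)) volume x y := by
    simpa using (hi (x + c) (y + c)).comp_add_right c
  rw [intervalIntegral.integral_sub (hshift b _ _) (hi _ _),
    intervalIntegral.integral_sub (hshift t _ _) (hi _ _),
    intervalIntegral.integral_comp_add_right, intervalIntegral.integral_comp_add_right,
    zero_add, zero_add, add_comm t b,
    intervalIntegral.integral_interval_sub_interval_comm' (hi _ _) (hi _ _) (hi _ _)]

variable [CompleteSpace E]

theorem ae_eq_of_forall_intervalIntegral_eq {f g : ℝ → E} (hf : LocallyIntegrable f)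
    (hg : LocallyIntegrable g) (h : ∀ b, ∫ s in (0 : ℝ)..b, f s = ∫ s in (0 : ℝ)..b, g s) :
    f =ᵐ[volume] g := by
  filter_upwards [LocallyIntegrable.ae_hasDerivAt_integral hf,
    LocallyIntegrable.ae_hasDerivAt_integral hg] with s hfs hgs
  exact (hfs 0).unique ((funext h : (fun b => ∫ s in (0 : ℝ)..b, f s) = _) ▸ hgs 0)

end IntervalIntegral

theorem ae_eq_const_iff_forall_ae_add {G E : Type*} [AddGroup G] [MeasurableSpace G]
    [MeasurableAdd₂ G] [MeasurableNeg G] {μ : Measure G} [SFinite μ] [μ.IsAddLeftInvariant]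
    [NeZero μ] [TopologicalSpace E] [TopologicalSpace.MetrizableSpace E] {g : G → E}
    (hg : AEStronglyMeasurable g μ) :
    (∃ c, g =ᵐ[μ] fun _ => c) ↔ ∀ t, ∀ᵐ s ∂μ, g (t + s) = g s := by
  constructor
  · rintro ⟨c, hc⟩ t
    filter_upwards [hc, (measurePreserving_add_left μ t).quasiMeasurePreserving.ae hc] with s h h'
    rw [h, h']
  · intro h
    obtain ⟨g', hg', hgg'⟩ := hg
    have h' : ∀ᵐ s ∂μ, ∀ᵐ t ∂μ, g' (t + s) = g' s := by
      refine (Measure.ae_ae_comm ?_).1 (ae_of_all _ fun t => ?_)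
      · exact (hg'.comp_measurable measurable_add).measurableSet_eq_fun
          (hg'.comp_measurable measurable_snd)
      · filter_upwards [h t, hgg', (measurePreserving_add_left μ t).quasiMeasurePreserving.ae hgg']
          with s h1 h2 h3
        rw [← h2, ← h3, h1]
    obtain ⟨s, hs⟩ := h'.exists
    refine ⟨g' s, hgg'.trans ?_⟩
    have hq := quasiMeasurePreserving_add_right μ (-s)
    filter_upwards [hq.ae hs] with t ht
    simpa using ht

theorem surjective_integral_of_nonneg {f : ℝ → ℝ} (hf : LocallyIntegrable f) (hf0 : ∀ x, 0 ≤ f x)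
    {a : ℝ} (hIio : ¬ IntegrableOn f (Set.Iio a)) (hIoi : ¬ IntegrableOn f (Set.Ioi a)) :
    Function.Surjective fun x => ∫ ζ in a..x, f ζ := by
  have hi (a b : ℝ) := intervalIntegrable_of_locallyIntegrable hf a b
  have hnorm (x : ℝ) : ‖f x‖ = f x := Real.norm_of_nonneg (hf0 x)
  intro y
  refine mem_range_of_exists_le_of_exists_ge (intervalIntegral.continuous_primitive hi a) ?_ ?_
  · by_contra! hlow
    refine hIio (IntegrableOn.mono_set ?_ Set.Iio_subset_Iic_self)
    refine integrableOn_Iic_of_intervalIntegral_norm_bounded (-y) a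
      (fun x => (hi x a).1) tendsto_id (Eventually.of_forall fun x => ?_)
    simp only [hnorm]
    rw [intervalIntegral.integral_symm]
    exact neg_le_neg (hlow x).le
  · by_contra! hupp
    refine hIoi (integrableOn_Ioi_of_intervalIntegral_norm_bounded y a
      (fun x => (hi a x).1) tendsto_id (Eventually.of_forall fun x => ?_))
    simp only [hnorm]
    exact (hupp x).le

theorem absolutelyContinuousOnInterval_of_dist_le {X Y : Type*} [PseudoMetricSpace X]
    [PseudoMetricSpace Y] {f : ℝ → X} {g : ℝ → Y} {a b : ℝ}
    (hg : AbsolutelyContinuousOnInterval g a b) (h : ∀ x y, dist (f x) (f y) ≤ dist (g x) (g y)) :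
    AbsolutelyContinuousOnInterval f a b :=
  squeeze_zero (fun _ => Finset.sum_nonneg fun _ _ => dist_nonneg)
    (fun _ => Finset.sum_le_sum fun _ _ => h _ _) hg

namespace LocAC

variable {z u : ℝ → ℂ}

theorem const_add_integral (hu : LocallyIntegrable u) (c : ℂ) :
    LocAC fun s => c + ∫ r in (0 : ℝ)..s, u r := by
  intro a b
  have hi (x y : ℝ) := intervalIntegrable_of_locallyIntegrable hu x y
  have hac : AbsolutelyContinuousOnInterval (fun s => ∫ r in a..s, ‖u r‖) a b :=
    (hi a b).norm.absolutelyContinuousOnInterval_intervalIntegral Set.left_mem_uIcc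
  refine absolutelyContinuousOnInterval_of_dist_le hac fun x y => ?_
  rw [dist_add_left, dist_eq_norm, dist_eq_norm,
    intervalIntegral.integral_interval_sub_left (hi _ _) (hi _ _),
    intervalIntegral.integral_interval_sub_left (hi _ _).norm (hi _ _).norm, Real.norm_eq_abs]
  exact intervalIntegral.norm_integral_le_abs_integral_norm

theorem eq_add_integral_deriv (hz : LocAC z) (hz' : LocallyIntegrable (deriv z)) (s : ℝ) :
    z s = z 0 + ∫ r in (0 : ℝ)..s, deriv z r := by
  have hsub := (hz 0 s).sub (const_add_integral hz' (z 0) 0 s)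
  obtain ⟨C, hC⟩ := hsub.const_of_ae_hasDerivAt_zero <| by
    filter_upwards [hz.ae_differentiableAt,
      LocallyIntegrable.ae_hasDerivAt_integral hz'] with r hr hr' _
    simpa using hr.hasDerivAt.sub ((hr' 0).const_add (z 0))
  have h0 := hC 0 Set.left_mem_uIcc
  have hs := hC s Set.right_mem_uIcc
  simp only [Pi.sub_apply, intervalIntegral.integral_same, add_zero, sub_self] at h0 hs
  rw [← sub_eq_zero, hs, h0]

end LocAC

theorem deriv_const_add_integral_ae {E : Type*} [NormedAddCommGroup E] [NormedSpace ℝ E]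
    [CompleteSpace E] {u : ℝ → E} (hu : LocallyIntegrable u) (c : E) :
    deriv (fun s => c + ∫ r in (0 : ℝ)..s, u r) =ᵐ[volume] u := by
  filter_upwards [LocallyIntegrable.ae_hasDerivAt_integral hu] with s hs
  exact ((hs 0).const_add c).deriv

/-! ### Generators of `C₀`-groups -/

section C0Group

variable {E F : Type*} [NormedAddCommGroup E] [NormedSpace ℂ E]
  [NormedAddCommGroup F] [NormedSpace ℂ F] {T : ℝ → E →L[ℂ] E} {x v : E}

theorem mem_graph_generator_iff :
    (x, v) ∈ (generator T).graph ↔ Tendsto (diffQuot T x) (𝓝[≠] 0) (𝓝 v) := by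
  rw [LinearPMap.mem_graph_iff]
  constructor
  · rintro ⟨y, rfl, rfl⟩
    exact Classical.choose_spec y.2
  · intro h
    have hx : ∃ v, Tendsto (diffQuot T x) (𝓝[≠] 0) (𝓝 v) := ⟨v, h⟩
    exact ⟨⟨x, hx⟩, rfl, tendsto_nhds_unique (Classical.choose_spec hx) h⟩

namespace IsC0Group

theorem mem_graph_generator_iff_hasDerivAt (hT : IsC0Group T) :
    (x, v) ∈ (generator T).graph ↔ HasDerivAt (fun t => T t x) v 0 := by
  have hslope : diffQuot T x = fun t => t⁻¹ • (T (0 + t) x - T 0 x) := by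
    funext t
    rw [diffQuot, Complex.coe_smul, zero_add, hT.map_zero, one_apply_eq_self]
  rw [mem_graph_generator_iff, hslope, hasDerivAt_iff_tendsto_slope_zero]

theorem hasDerivAt (hT : IsC0Group T) (h : (x, v) ∈ (generator T).graph) (t : ℝ) :
    HasDerivAt (fun t => T t x) (T t v) t := by
  have h0 := hT.mem_graph_generator_iff_hasDerivAt.1 h
  rw [← sub_self t] at h0
  have hcomp := (T t).restrictScalars ℝ |>.hasFDerivAt.comp_hasDerivAt t (h0.comp_sub_const t t)
  simpa [Function.comp_def, ← mul_apply_eq_comp, ← hT.map_add] using hcomp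

theorem mem_graph_generator_iff_integral [CompleteSpace E] (hT : IsC0Group T) :
    (x, v) ∈ (generator T).graph ↔ ∀ t, T t x - x = ∫ r in (0 : ℝ)..t, T r v := by
  have hcont := hT.continuous_orbit v
  constructor
  · intro h t
    rw [intervalIntegral.integral_eq_sub_of_hasDerivAt (fun r _ => hT.hasDerivAt h r)
      (hcont.intervalIntegrable 0 t), hT.map_zero, one_apply_eq_self]
  · intro h
    have hint := (hcont.integral_hasStrictDerivAt 0 0).hasDerivAt.add_const x
    simp only [← h, sub_add_cancel, hT.map_zero, one_apply_eq_self] at hint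
    exact hT.mem_graph_generator_iff_hasDerivAt.2 hint

theorem conj (hT : IsC0Group T) (Φ : E ≃L[ℂ] F) :
    IsC0Group fun t => Φ.conjContinuousAlgEquiv (T t) where
  map_zero := by rw [hT.map_zero, map_one]
  map_add s t := by rw [hT.map_add, map_mul]
  continuous_orbit y := Φ.continuous.comp (hT.continuous_orbit (Φ.symm y))

end IsC0Group

theorem mem_graph_generator_conj_iff (Φ : E ≃L[ℂ] F) :
    (Φ x, Φ v) ∈ (generator fun t => Φ.conjContinuousAlgEquiv (T t)).graph ↔
      (x, v) ∈ (generator T).graph := by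
  have hquot : diffQuot (fun t => Φ.conjContinuousAlgEquiv (T t)) (Φ x) = Φ ∘ diffQuot T x := by
    funext t
    simp [diffQuot]
  rw [mem_graph_generator_iff, mem_graph_generator_iff, hquot]
  exact (Φ.toHomeomorph.isInducing.tendsto_nhds_iff).symm

theorem IsC0Group.mem_unitary {H : Type*} [NormedAddCommGroup H] [InnerProductSpace ℂ H]
    [CompleteSpace H] {T : ℝ → H →L[ℂ] H} (hT : IsC0Group T)
    (hnorm : ∀ t x, ‖T t x‖ = ‖x‖) (t : ℝ) : T t ∈ unitary (H →L[ℂ] H) := by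
  have hstar : star (T t) * T t = 1 := (T t).norm_map_iff_adjoint_comp_self.1 (hnorm t)
  have hneg : T t * T (-t) = 1 := by rw [← hT.map_add, add_neg_cancel, hT.map_zero]
  have hadj : star (T t) = T (-t) := left_inv_eq_right_inv hstar hneg
  exact Unitary.mem_iff.2 ⟨hstar, hadj ▸ hneg⟩

end C0Group

/-! ### The translation group on `Lᵖ(ℝ; E)` -/

theorem locallyIntegrable_coe_Lp {X E : Type*} [TopologicalSpace X] [MeasurableSpace X]
    [NormedAddCommGroup E] {p : ℝ≥0∞} [Fact (1 ≤ p)] {μ : Measure X} [IsLocallyFiniteMeasure μ]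
    (f : Lp E p μ) : LocallyIntegrable f μ :=
  (Lp.memLp f).locallyIntegrable Fact.out

section Translation

variable {E : Type*} [NormedAddCommGroup E] [NormedSpace ℂ E] {p : ℝ≥0∞} [Fact (1 ≤ p)]

/-- Left translation `f ↦ f (t + ·)` as a bounded operator on `Lᵖ(ℝ; E)`. -/
def translation (t : ℝ) :
    Lp E p (volume : Measure ℝ) →L[ℂ] Lp E p (volume : Measure ℝ) :=
  (Lp.compMeasurePreservingₗᵢ ℂ (t + ·)
    (measurePreserving_add_left volume t)).toContinuousLinearMap

theorem norm_translation (t : ℝ) (f : Lp E p (volume : Measure ℝ)) :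
    ‖translation t f‖ = ‖f‖ :=
  LinearIsometry.norm_map _ f

theorem translation_apply_ae (t : ℝ) (f : Lp E p (volume : Measure ℝ)) :
    ∀ᵐ s, translation t f s = f (t + s) :=
  Lp.coeFn_compMeasurePreserving f (measurePreserving_add_left volume t)

theorem isC0Group_translation (hp : p ≠ ∞) :
    IsC0Group (translation : ℝ → Lp E p (volume : Measure ℝ) →L[ℂ] _) where
  map_zero := by
    ext1 f
    exact zero_vadd ℝᵈᵃᵃ f
  map_add s t := by
    ext1 f
    rw [add_comm]
    exact add_vadd (DomAddAct.mk s) (DomAddAct.mk t) f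
  continuous_orbit f := by
    have : Fact (p ≠ ∞) := ⟨hp⟩
    have : Continuous (DomAddAct.mk : ℝ → ℝᵈᵃᵃ) := DomAddAct.continuous_mk
    exact this.vadd continuous_const

variable [CompleteSpace E]

/-- Integration over a set of finite measure, as a bounded linear map on `Lᵖ`; it is the pairing
with the indicator function in the dual exponent. -/
def setIntegralCLM (p : ℝ≥0∞) [Fact (1 ≤ p)] {X : Type*} [MeasurableSpace X] {μ : Measure X}
    {s : Set X} (hs : MeasurableSet s) (hμs : μ s ≠ ∞) : Lp E p μ →L[ℂ] E :=
  haveI : Fact (1 ≤ p.conjExponent) := ⟨ENNReal.HolderConjugate.one_le _ p⟩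
  (ContinuousLinearMap.lsmul ℂ ℂ).lpPairing μ p.conjExponent p (indicatorConstLp _ hs hμs 1)

theorem setIntegralCLM_apply {X : Type*} [MeasurableSpace X] {μ : Measure X} {s : Set X}
    (hs : MeasurableSet s) (hμs : μ s ≠ ∞) (f : Lp E p μ) :
    setIntegralCLM p hs hμs f = ∫ x in s, f x ∂μ := by
  rw [setIntegralCLM, ContinuousLinearMap.lpPairing_eq_integral, ← integral_indicator hs]
  refine integral_congr_ae ?_
  filter_upwards [indicatorConstLp_coeFn (p := p.conjExponent) (hs := hs) (hμs := hμs)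
    (c := (1 : ℂ))] with x hx
  rw [hx, ContinuousLinearMap.lsmul_apply]
  by_cases h : x ∈ s <;> simp [h]

theorem intervalIntegral_intervalIntegral_Lp_comm {f : ℝ → Lp E p (volume : Measure ℝ)} {a b : ℝ}
    (hf : IntervalIntegrable f volume a b) (c d : ℝ) :
    ∫ s in c..d, (∫ r in a..b, f r : Lp E p (volume : Measure ℝ)) s =
      ∫ r in a..b, ∫ s in c..d, f r s := by
  let L : Lp E p (volume : Measure ℝ) →L[ℂ] E :=
    setIntegralCLM p (measurableSet_Ioc (a := c) (b := d)) (by simp) -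
      setIntegralCLM p (measurableSet_Ioc (a := d) (b := c)) (by simp)
  have hL (g : Lp E p (volume : Measure ℝ)) : L g = ∫ s in c..d, g s := by
    simp only [L, sub_apply, setIntegralCLM_apply, intervalIntegral]
  simp only [← hL]
  exact (L.intervalIntegral_comp_comm hf).symm

theorem integral_translation_ae (hp : p ≠ ∞) (u : Lp E p (volume : Measure ℝ)) (t : ℝ) :
    ∀ᵐ s, (∫ r in (0 : ℝ)..t, translation r u : Lp E p (volume : Measure ℝ)) s =
      ∫ r in s..t + s, u r := by
  have hu := locallyIntegrable_coe_Lp u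
  have hi (a b : ℝ) := intervalIntegrable_of_locallyIntegrable hu a b
  set U : ℝ → E := fun s => ∫ r in (0 : ℝ)..s, u r
  have hU : Continuous U := intervalIntegral.continuous_primitive hi 0
  have hUsub (a b : ℝ) : ∫ r in a..b, u r = U b - U a :=
    (intervalIntegral.integral_interval_sub_left (hi 0 b) (hi 0 a)).symm
  simp only [hUsub]
  refine ae_eq_of_forall_intervalIntegral_eq (locallyIntegrable_coe_Lp _)
    (by fun_prop : Continuous fun s => U (t + s) - U s).locallyIntegrable fun b => ?_
  have hshift (r : ℝ) : ∫ s in (0 : ℝ)..b, translation r u s = U (r + b) - U r := by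
    rw [intervalIntegral.integral_congr_ae
      ((translation_apply_ae r u).mono fun s hs _ => hs),
      intervalIntegral.integral_comp_add_left (fun s => u s), add_zero, hUsub]
  calc ∫ s in (0 : ℝ)..b, (∫ r in (0 : ℝ)..t, translation r u : Lp E p (volume : Measure ℝ)) s
    _ = ∫ r in (0 : ℝ)..t, ∫ s in (0 : ℝ)..b, translation r u s :=
      intervalIntegral_intervalIntegral_Lp_comm
        (((isC0Group_translation hp).continuous_orbit u).intervalIntegrable 0 t) 0 b
    _ = ∫ r in (0 : ℝ)..t, (U (r + b) - U r) := by simp only [hshift]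
    _ = ∫ s in (0 : ℝ)..b, (U (t + s) - U s) := by
      simp only [integral_add_sub_comm hU.locallyIntegrable, add_comm t]

theorem mem_graph_generator_translation_iff (hp : p ≠ ∞) {y u : Lp E p (volume : Measure ℝ)} :
    (y, u) ∈ (generator translation).graph ↔
      ∃ c, ∀ᵐ s, y s = c + ∫ r in (0 : ℝ)..s, u r := by
  have hi (a b : ℝ) := intervalIntegrable_of_locallyIntegrable (locallyIntegrable_coe_Lp u) a b
  set U : ℝ → E := fun s => ∫ r in (0 : ℝ)..s, u r
  have hU : Continuous U := intervalIntegral.continuous_primitive hi 0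
  have hpointwise (t : ℝ) : translation t y - y = ∫ r in (0 : ℝ)..t, translation r u ↔
      ∀ᵐ s, y (t + s) - U (t + s) = y s - U s := by
    rw [Lp.ext_iff]
    refine eventually_congr ?_
    filter_upwards [Lp.coeFn_sub (translation t y) y, translation_apply_ae t y,
      integral_translation_ae hp u t] with s hsub htrans hint
    rw [hsub, Pi.sub_apply, htrans, hint,
      ← intervalIntegral.integral_interval_sub_left (hi 0 (t + s)) (hi 0 s),
      sub_eq_sub_iff_sub_eq_sub]
  have hconst := ae_eq_const_iff_forall_ae_add (μ := volume)
    ((Lp.aestronglyMeasurable y).sub hU.aestronglyMeasurable)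
  calc (y, u) ∈ (generator translation).graph
    _ ↔ ∀ t, translation t y - y = ∫ r in (0 : ℝ)..t, translation r u :=
      (isC0Group_translation hp).mem_graph_generator_iff_integral
    _ ↔ ∃ c, ∀ᵐ s, y s - U s = c := (forall_congr' hpointwise).trans hconst.symm
    _ ↔ ∃ c, ∀ᵐ s, y s = c + U s := by simp only [sub_eq_iff_eq_add]

end Translation

/-! ### The change of variables `p_w` -/

section PFun

variable {w : ℝ → ℝ}

theorem pFun_add_muFun (hsurj : Function.Surjective (pFun w)) (ξ t : ℝ) :
    pFun w (ξ + muFun w ξ t) = pFun w ξ + t := by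
  rw [muFun, add_sub_cancel, Function.invFun_eq (hsurj _)]

variable (hw : Continuous w) (hw0 : ∀ ξ, w ξ ≠ 0)

include hw hw0

theorem pos_or_neg_of_continuous : (∀ ξ, 0 < w ξ) ∨ ∀ ξ, w ξ < 0 := by
  by_contra! h
  obtain ⟨⟨a, ha⟩, b, hb⟩ := h
  obtain ⟨c, hc⟩ := mem_range_of_exists_le_of_exists_ge hw ⟨a, ha⟩ ⟨b, hb⟩
  exact hw0 c hc

theorem hasStrictDerivAt_pFun (ξ : ℝ) : HasStrictDerivAt (pFun w) (w ξ)⁻¹ ξ :=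
  (hw.inv₀ hw0).integral_hasStrictDerivAt 0 ξ

theorem continuous_pFun : Continuous (pFun w) :=
  continuous_iff_continuousAt.2 fun ξ => (hasStrictDerivAt_pFun hw hw0 ξ).hasDerivAt.continuousAt

theorem injective_pFun : Function.Injective (pFun w) := by
  have hderiv (ξ : ℝ) : HasDerivAt (pFun w) (w ξ)⁻¹ ξ := (hasStrictDerivAt_pFun hw hw0 ξ).hasDerivAt
  rcases pos_or_neg_of_continuous hw hw0 with hpos | hneg
  · exact (strictMono_of_hasDerivAt_pos hderiv fun ξ => inv_pos.2 (hpos ξ)).injective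
  · exact (strictAnti_of_hasDerivAt_neg hderiv fun ξ => inv_lt_zero.2 (hneg ξ)).injective

theorem bijective_pFun (hIio : ¬ IntegrableOn (fun ξ => (w ξ)⁻¹) (Set.Iio 0))
    (hIoi : ¬ IntegrableOn (fun ξ => (w ξ)⁻¹) (Set.Ioi 0)) : Function.Bijective (pFun w) := by
  refine ⟨injective_pFun hw hw0, ?_⟩
  have hloc : LocallyIntegrable fun ξ => (w ξ)⁻¹ := (hw.inv₀ hw0).locallyIntegrable
  rcases pos_or_neg_of_continuous hw hw0 with hpos | hneg
  · exact surjective_integral_of_nonneg hloc (fun ξ => (inv_pos.2 (hpos ξ)).le) hIio hIoi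
  · have hsurj := surjective_integral_of_nonneg hloc.neg
      (fun ξ => neg_nonneg.2 (inv_lt_zero.2 (hneg ξ)).le)
      (fun h => hIio (integrable_neg_iff.1 h)) (fun h => hIoi (integrable_neg_iff.1 h))
    convert neg_surjective.comp hsurj using 1
    funext ξ
    simp [pFun, intervalIntegral.integral_neg]

theorem integral_inv_smul_comp_pFun {E : Type*} [NormedAddCommGroup E] [NormedSpace ℝ E]
    (g : ℝ → E) (a b : ℝ) :
    ∫ ζ in a..b, (w ζ)⁻¹ • g (pFun w ζ) = ∫ s in pFun w a..pFun w b, g s := by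
  have hderiv (ζ : ℝ) : HasDerivAt (pFun w) (w ζ)⁻¹ ζ := (hasStrictDerivAt_pFun hw hw0 ζ).hasDerivAt
  have hcont := continuous_pFun hw hw0
  rcases pos_or_neg_of_continuous hw hw0 with hpos | hneg
  · exact intervalIntegral.integral_deriv_smul_comp_of_deriv_nonneg hcont.continuousOn
      (fun ζ _ => hderiv ζ) fun ζ _ => inv_nonneg.2 (hpos ζ).le
  · exact intervalIntegral.integral_deriv_smul_comp_of_deriv_nonpos hcont.continuousOn
      (fun ζ _ => hderiv ζ) fun ζ _ => inv_nonpos.2 (hneg ζ).le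

theorem ae_weightMeasure_iff {P : ℝ → Prop} : (∀ᵐ ξ ∂weightMeasure w, P ξ) ↔ ∀ᵐ ξ, P ξ :=
  ⟨fun h => (volume_ac_weightMeasure hw hw0).ae_le h, fun h => (weightMeasure_ac_volume w).ae_le h⟩

theorem isOpenMap_pFun : IsOpenMap (pFun w) :=
  isOpenMap_of_hasStrictDerivAt (hasStrictDerivAt_pFun hw hw0) fun ξ => inv_ne_zero (hw0 ξ)

variable (hbij : Function.Bijective (pFun w))

/-- `p_w` as a homeomorphism of the line. -/
def pHomeo : ℝ ≃ₜ ℝ :=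
  (Equiv.ofBijective (pFun w) hbij).toHomeomorphOfContinuousOpen (continuous_pFun hw hw0)
    (isOpenMap_pFun hw hw0)

theorem coe_pHomeo : ⇑(pHomeo hw hw0 hbij) = pFun w := rfl

include hbij

theorem measurePreserving_pHomeo :
    MeasurePreserving (pHomeo hw hw0 hbij) (weightMeasure w⁻¹) volume := by
  refine ⟨(pHomeo hw hw0 hbij).continuous.measurable, ?_⟩
  have h := map_withDensity_abs_det_fderiv_eq_addHaar (volume : Measure ℝ)
    MeasurableSet.univ.nullMeasurableSet
    (fun ξ _ => (hasStrictDerivAt_pFun hw hw0 ξ).hasDerivAt.hasFDerivAt.hasFDerivWithinAt)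
    hbij.injective.injOn
  rw [Set.image_univ, hbij.surjective.range_eq, Measure.restrict_univ] at h
  simpa [weightMeasure, coe_pHomeo] using h

theorem ae_comp_pFun_iff {P : ℝ → Prop} : (∀ᵐ ξ, P (pFun w ξ)) ↔ ∀ᵐ s, P s := by
  rw [← ae_weightMeasure_iff (hw.inv₀ hw0) fun ξ => inv_ne_zero (hw0 ξ),
    ← (measurePreserving_pHomeo hw hw0 hbij).map_eq,
    (pHomeo hw hw0 hbij).measurableEmbedding.ae_map_iff]
  rfl

theorem ae_add_muFun {P : ℝ → Prop} (h : ∀ᵐ ξ, P ξ) (t : ℝ) : ∀ᵐ ξ, P (ξ + muFun w ξ t) := by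
  set e := pHomeo hw hw0 hbij
  have hsymm : ∀ᵐ s, P (e.symm s) :=
    (ae_comp_pFun_iff hw hw0 hbij).1 <| h.mono fun ξ hξ => by
      rwa [← coe_pHomeo hw hw0 hbij, e.symm_apply_apply]
  have htrans : ∀ᵐ s, P (e.symm (s + t)) :=
    (measurePreserving_add_right volume t).quasiMeasurePreserving.ae hsymm
  filter_upwards [(ae_comp_pFun_iff hw hw0 hbij).2 htrans] with ξ hξ
  rwa [← pFun_add_muFun hbij.surjective, ← coe_pHomeo hw hw0 hbij, e.symm_apply_apply] at hξ

end PFun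

/-! ### The unitary equivalence of `L²(ℝ)` and `L²_{|w|}(ℝ)` -/

section CompMeasurePreserving

variable {X Y E : Type*} [MeasurableSpace X] [MeasurableSpace Y] {μ : Measure X} {ν : Measure Y}
  [NormedAddCommGroup E] {p : ℝ≥0∞} [Fact (1 ≤ p)]

/-- Composition with a measure preserving equivalence, as an isometry of `Lᵖ`-spaces. -/
def compMeasurePreservingEquiv (𝕜 : Type*) [NormedRing 𝕜] [Module 𝕜 E] [IsBoundedSMul 𝕜 E]
    (e : X ≃ᵐ Y) (he : MeasurePreserving e μ ν) : Lp E p ν ≃ₗᵢ[𝕜] Lp E p μ :=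
  .ofSurjective (Lp.compMeasurePreservingₗᵢ 𝕜 e he) fun g => by
    let g' := Lp.compMeasurePreserving e.symm (he.symm e) g
    refine ⟨g', Lp.ext ?_⟩
    filter_upwards [Lp.coeFn_compMeasurePreserving g' he,
      he.quasiMeasurePreserving.ae (Lp.coeFn_compMeasurePreserving g (he.symm e))] with x hx hx'
    exact hx.trans (hx'.trans (by simp))

end CompMeasurePreserving

section WeightedL2

variable {w : ℝ → ℝ} (hw : Continuous w) (hw0 : ∀ ξ, w ξ ≠ 0)

include hw hw0

theorem locallyIntegrable_of_weightMeasure {E : Type*} [NormedAddCommGroup E] [NormedSpace ℝ E]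
    {v : ℝ → E} (hv : LocallyIntegrable v (weightMeasure w)) : LocallyIntegrable v := by
  have hsmul : LocallyIntegrable fun ξ => |w ξ| • v ξ := by
    refine locallyIntegrable_iff.2 fun K hK => ?_
    have hvK := hv.integrableOn_isCompact hK
    rw [IntegrableOn, weightMeasure, restrict_withDensity hK.measurableSet,
      integrable_withDensity_iff_integrable_smul' (by fun_prop) (by simp)] at hvK
    simpa only [IntegrableOn, ENNReal.toReal_ofReal (abs_nonneg _)] using hvK
  have hw0' (ξ : ℝ) : |w ξ| ≠ 0 := abs_ne_zero.2 (hw0 ξ)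
  simpa only [Pi.inv_apply, inv_smul_smul₀ (hw0' _)] using hsmul.continuous_smul (hw.abs.inv₀ hw0')

theorem locallyIntegrable_coe_weightedL2 (v : WeightedL2 w) : LocallyIntegrable v :=
  haveI : IsLocallyFiniteMeasure (weightMeasure w) :=
    IsLocallyFiniteMeasure.withDensity_ofReal hw.abs
  locallyIntegrable_of_weightMeasure hw hw0 (locallyIntegrable_coe_Lp v)

theorem eLpNorm_mul_weight (x : ℝ → ℂ) :
    eLpNorm (fun ξ => (w ξ : ℂ) * x ξ) 2 (weightMeasure w⁻¹) = eLpNorm x 2 (weightMeasure w) := by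
  have hcancel (ξ : ℝ) : ENNReal.ofReal |(w ξ)⁻¹| * ‖(w ξ : ℂ)‖ₑ ^ 2 = ENNReal.ofReal |w ξ| := by
    rw [← ofReal_norm, Complex.norm_real, Real.norm_eq_abs, ← ENNReal.ofReal_pow (abs_nonneg _),
      ← ENNReal.ofReal_mul (abs_nonneg _), abs_inv, sq,
      inv_mul_cancel_left₀ (abs_ne_zero.2 (hw0 ξ))]
  have : Continuous w⁻¹ := hw.inv₀ hw0
  simp only [eLpNorm_eq_lintegral_rpow_enorm_toReal two_ne_zero ENNReal.ofNat_ne_top]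
  rw [weightMeasure, weightMeasure,
    lintegral_withDensity_eq_lintegral_mul_non_measurable _ (by fun_prop) (by simp),
    lintegral_withDensity_eq_lintegral_mul_non_measurable _ (by fun_prop) (by simp)]
  congr 1
  refine lintegral_congr fun ξ => ?_
  simp only [Pi.mul_apply, Pi.inv_apply, ENNReal.toReal_ofNat, ENNReal.rpow_ofNat, enorm_mul,
    mul_pow, ← mul_assoc, hcancel]

theorem weightMeasure_ac_weightMeasure (w' : ℝ → ℝ) : weightMeasure w' ≪ weightMeasure w :=
  (weightMeasure_ac_volume w').trans (volume_ac_weightMeasure hw hw0)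

theorem memLp_mul_weight {x : ℝ → ℂ} (hx : MemLp x 2 (weightMeasure w)) :
    MemLp (fun ξ => (w ξ : ℂ) * x ξ) 2 (weightMeasure w⁻¹) :=
  ⟨(Complex.continuous_ofReal.comp hw).aestronglyMeasurable.mul
    (hx.1.mono_ac (weightMeasure_ac_weightMeasure hw hw0 w⁻¹)),
    (eLpNorm_mul_weight hw hw0 x).trans_lt hx.2⟩

theorem memLp_inv_mul {x : ℝ → ℂ} (hx : MemLp x 2 (weightMeasure w⁻¹)) :
    MemLp (fun ξ => (w ξ : ℂ)⁻¹ * x ξ) 2 (weightMeasure w) := by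
  simpa using memLp_mul_weight (hw.inv₀ hw0) (fun ξ => inv_ne_zero (hw0 ξ)) hx

/-- Multiplication by `w`, as an isometric equivalence of `L²_{|w|}(ℝ)` and `L²_{|w|⁻¹}(ℝ)`. -/
def mulWeight : WeightedL2 w ≃ₗᵢ[ℂ] WeightedL2 w⁻¹ :=
  .ofSurjective
    { toFun x := (memLp_mul_weight hw hw0 (Lp.memLp x)).toLp
      map_add' x x' := by
        rw [← MemLp.toLp_add]
        refine MemLp.toLp_congr _ _ ((weightMeasure_ac_weightMeasure hw hw0 w⁻¹).ae_le ?_)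
        filter_upwards [Lp.coeFn_add x x'] with ξ hξ
        rw [hξ, Pi.add_apply, Pi.add_apply, mul_add]
      map_smul' c x := by
        rw [RingHom.id_apply, ← MemLp.toLp_const_smul]
        refine MemLp.toLp_congr _ _ ((weightMeasure_ac_weightMeasure hw hw0 w⁻¹).ae_le ?_)
        filter_upwards [Lp.coeFn_smul c x] with ξ hξ
        rw [hξ, Pi.smul_apply, Pi.smul_apply, smul_eq_mul, smul_eq_mul, mul_left_comm]
      norm_map' x := by
        change ‖(memLp_mul_weight hw hw0 (Lp.memLp x)).toLp _‖ = _
        rw [Lp.norm_toLp, eLpNorm_mul_weight hw hw0, Lp.norm_def] }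
    fun y => by
      have hx := memLp_inv_mul hw hw0 (Lp.memLp y)
      refine ⟨hx.toLp, Lp.ext ((memLp_mul_weight hw hw0 (Lp.memLp _)).coeFn_toLp.trans ?_)⟩
      filter_upwards [(weightMeasure_ac_weightMeasure hw hw0 w⁻¹).ae_le hx.coeFn_toLp] with ξ hξ
      rw [hξ, mul_inv_cancel_left₀ (Complex.ofReal_ne_zero.2 (hw0 ξ))]

theorem mulWeight_apply_ae (x : WeightedL2 w) : ∀ᵐ ξ, mulWeight hw hw0 x ξ = w ξ * x ξ :=
  (ae_weightMeasure_iff (hw.inv₀ hw0) fun ξ => inv_ne_zero (hw0 ξ)).1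
    (memLp_mul_weight hw hw0 (Lp.memLp x)).coeFn_toLp

variable (hbij : Function.Bijective (pFun w))

/-- The unitary equivalence `y ↦ w⁻¹ (y ∘ p_w)` of `L²(ℝ)` and `L²_{|w|}(ℝ)`. -/
def pullback : Lp ℂ 2 (volume : Measure ℝ) ≃ₗᵢ[ℂ] WeightedL2 w :=
  (compMeasurePreservingEquiv ℂ (pHomeo hw hw0 hbij).toMeasurableEquiv
    (measurePreserving_pHomeo hw hw0 hbij)).trans (mulWeight hw hw0).symm

include hbij

theorem mul_pullback_ae (y : Lp ℂ 2 (volume : Measure ℝ)) :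
    ∀ᵐ ξ, w ξ * pullback hw hw0 hbij y ξ = y (pFun w ξ) := by
  have hcomp := Lp.coeFn_compMeasurePreserving y (measurePreserving_pHomeo hw hw0 hbij)
  filter_upwards [mulWeight_apply_ae hw hw0 (pullback hw hw0 hbij y),
    (ae_weightMeasure_iff (hw.inv₀ hw0) fun ξ => inv_ne_zero (hw0 ξ)).1 hcomp] with ξ hmul hcomp
  rw [← hmul, pullback, LinearIsometryEquiv.trans_apply, LinearIsometryEquiv.apply_symm_apply]
  exact hcomp

end WeightedL2

/-! ### The transport group -/

section Transport

variable {w : ℝ → ℝ} {hw : Continuous w} {hw0 : ∀ ξ, w ξ ≠ 0}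

theorem mem_graph_transportOp_iff {x v : WeightedL2 w} :
    (x, v) ∈ (transportOp w hw hw0).graph ↔ ∃ z, IsACRep w x z ∧ deriv z =ᵐ[volume] v := by
  rw [LinearPMap.mem_graph_iff]
  constructor
  · rintro ⟨y, rfl, rfl⟩
    have hz := Classical.choose_spec y.2
    exact ⟨_, hz, ((ae_weightMeasure_iff hw hw0).1 hz.memLp.coeFn_toLp).mono fun _ => Eq.symm⟩
  · rintro ⟨z, hz, hv⟩
    have hx : ∃ z, IsACRep w x z := ⟨z, hz⟩
    have hz' := Classical.choose_spec hx
    refine ⟨⟨x, hx⟩, rfl, Lp.ext (hz'.memLp.coeFn_toLp.trans ?_)⟩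
    rw [hz'.unique hz]
    exact (ae_weightMeasure_iff hw hw0).2 hv

theorem mem_graph_transportOp_iff_integral {x v : WeightedL2 w} :
    (x, v) ∈ (transportOp w hw hw0).graph ↔
      ∃ c : ℂ, ∀ᵐ ξ, w ξ * x ξ = c + ∫ ζ in (0 : ℝ)..ξ, v ζ := by
  have hv := locallyIntegrable_coe_weightedL2 hw hw0 v
  rw [mem_graph_transportOp_iff]
  constructor
  · rintro ⟨z, hz, hzv⟩
    refine ⟨z 0, hz.ae_eq.mono fun ξ hξ => ?_⟩
    rw [← hξ, hz.locAC.eq_add_integral_deriv (hv.congr hzv.symm),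
      intervalIntegral.integral_congr_ae (hzv.mono fun ζ hζ _ => hζ)]
  · rintro ⟨c, hc⟩
    have hderiv := deriv_const_add_integral_ae hv c
    exact ⟨_, ⟨LocAC.const_add_integral hv c, hc.mono fun _ => Eq.symm,
      (Lp.memLp v).ae_eq ((ae_weightMeasure_iff hw hw0).2 hderiv.symm)⟩, hderiv⟩

variable {hbij : Function.Bijective (pFun w)}

theorem mem_graph_transportOp_pullback_iff {y u : Lp ℂ 2 (volume : Measure ℝ)} :
    (pullback hw hw0 hbij y, pullback hw hw0 hbij u) ∈ (transportOp w hw hw0).graph ↔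
      ∃ c : ℂ, ∀ᵐ s, y s = c + ∫ r in (0 : ℝ)..s, u r := by
  have hint (ξ : ℝ) :
      ∫ ζ in (0 : ℝ)..ξ, pullback hw hw0 hbij u ζ = ∫ r in (0 : ℝ)..pFun w ξ, u r := by
    have hp0 : pFun w 0 = 0 := intervalIntegral.integral_same
    nth_rw 2 [← hp0]
    rw [← integral_inv_smul_comp_pFun hw hw0]
    refine intervalIntegral.integral_congr_ae ?_
    filter_upwards [mul_pullback_ae hw hw0 hbij u] with ζ hζ _
    rw [← hζ, Complex.real_smul, Complex.ofReal_inv,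
      inv_mul_cancel_left₀ (Complex.ofReal_ne_zero.2 (hw0 ζ))]
  rw [mem_graph_transportOp_iff_integral]
  refine exists_congr fun c => ?_
  rw [← ae_comp_pFun_iff hw hw0 hbij (P := fun s => y s = c + ∫ r in (0 : ℝ)..s, u r)]
  refine eventually_congr ?_
  filter_upwards [mul_pullback_ae hw hw0 hbij y] with ξ hξ
  rw [hξ, hint]

variable (hw hw0 hbij)

/-- The translation group, transported to `L²_{|w|}(ℝ)` by the unitary equivalence `pullback`. -/
def transportGroup (t : ℝ) : WeightedL2 w →L[ℂ] WeightedL2 w :=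
  (pullback hw hw0 hbij).toContinuousLinearEquiv.conjContinuousAlgEquiv (translation t)

theorem isC0Group_transportGroup : IsC0Group (transportGroup hw hw0 hbij) :=
  (isC0Group_translation (p := 2) ENNReal.ofNat_ne_top).conj _

theorem transportGroup_pullback (t : ℝ) (y : Lp ℂ 2 (volume : Measure ℝ)) :
    transportGroup hw hw0 hbij t (pullback hw hw0 hbij y) =
      pullback hw hw0 hbij (translation t y) := by
  simp [transportGroup]

theorem transportGroup_mem_unitary (t : ℝ) :
    transportGroup hw hw0 hbij t ∈ unitary (WeightedL2 w →L[ℂ] WeightedL2 w) := by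
  refine (isC0Group_transportGroup hw hw0 hbij).mem_unitary (fun t x => ?_) t
  obtain ⟨y, rfl⟩ := (pullback hw hw0 hbij).surjective x
  rw [transportGroup_pullback, LinearIsometryEquiv.norm_map, LinearIsometryEquiv.norm_map,
    norm_translation]

theorem generator_transportGroup :
    generator (transportGroup hw hw0 hbij) = transportOp w hw hw0 := by
  refine LinearPMap.eq_of_eq_graph (SetLike.ext ?_)
  rintro ⟨x, v⟩
  obtain ⟨y, rfl⟩ := (pullback hw hw0 hbij).surjective x
  obtain ⟨u, rfl⟩ := (pullback hw hw0 hbij).surjective v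
  rw [mem_graph_transportOp_pullback_iff,
    ← mem_graph_generator_translation_iff (p := 2) ENNReal.ofNat_ne_top]
  exact mem_graph_generator_conj_iff (pullback hw hw0 hbij).toContinuousLinearEquiv

theorem transportGroup_apply_ae (t : ℝ) (x : WeightedL2 w) :
    ∀ᵐ ξ, transportGroup hw hw0 hbij t x ξ =
      ((w (ξ + muFun w ξ t) / w ξ : ℝ) : ℂ) * x (ξ + muFun w ξ t) := by
  obtain ⟨y, rfl⟩ := (pullback hw hw0 hbij).surjective x
  rw [transportGroup_pullback]
  filter_upwards [mul_pullback_ae hw hw0 hbij (translation t y),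
    (ae_comp_pFun_iff hw hw0 hbij).2 (translation_apply_ae t y),
    ae_add_muFun hw hw0 hbij (mul_pullback_ae hw hw0 hbij y) t] with ξ hleft htrans hright
  have hwξ : (w ξ : ℂ) ≠ 0 := Complex.ofReal_ne_zero.2 (hw0 ξ)
  rw [Complex.ofReal_div, div_mul_eq_mul_div, eq_div_iff hwξ, mul_comm, hleft, htrans, hright,
    pFun_add_muFun hbij.surjective, add_comm]

end Transport

end WeightedTransport

end

open WeightedTransport in
theorem proposition4p1 (w : ℝ → ℝ) (hw : Continuous w) (hw0 : ∀ ξ, w ξ ≠ 0)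
    (hneg : ¬ IntegrableOn (fun ξ => (w ξ)⁻¹) (Set.Iio 0))
    (hpos : ¬ IntegrableOn (fun ξ => (w ξ)⁻¹) (Set.Ioi 0)) :
    Function.Bijective (pFun w) ∧
    ∃ T : ℝ → WeightedL2 w →L[ℂ] WeightedL2 w,
      IsC0Group T ∧
      (∀ t : ℝ, T t ∈ unitary (WeightedL2 w →L[ℂ] WeightedL2 w)) ∧
      generator T = transportOp w hw hw0 ∧
      ∀ (t : ℝ) (x : ℝ → ℂ) (hx : MemLp x 2 (weightMeasure w)),
        ∀ᵐ ξ : ℝ, T t (hx.toLp x) ξ =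
          ((w (ξ + muFun w ξ t) / w ξ : ℝ) : ℂ) * x (ξ + muFun w ξ t) := by
  have hbij := bijective_pFun hw hw0 hneg hpos
  refine ⟨hbij, transportGroup hw hw0 hbij, isC0Group_transportGroup hw hw0 hbij,
    transportGroup_mem_unitary hw hw0 hbij, generator_transportGroup hw hw0 hbij, fun t x hx => ?_⟩
  have hcoe : ∀ᵐ ξ, hx.toLp x ξ = x ξ := (ae_weightMeasure_iff hw hw0).1 hx.coeFn_toLp
  filter_upwards [transportGroup_apply_ae hw hw0 hbij t (hx.toLp x),
    ae_add_muFun hw hw0 hbij hcoe t] with ξ happly hcoe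
  rw [happly, hcoe]
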